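/- For a complex number $q$ with $0<|q|<1$ let $\vartheta_1(z|q)=2q^{1/4}\sum_{n\ge 0}(-1)^nq^{n(n+1)}\sin((2n+1)z)$, $\vartheta_2(z|q)=2q^{1/4}\sum_{n\ge 0}q^{n(n+1)}\cos((2n+1)z)$, $\vartheta_3(z|q)=1+2\sum_{n\ge 1}q^{n^2}\cos(2nz)$, $\vartheta_4(z|q)=1+2\sum_{n\ge 1}(-1)^nq^{n^2}\cos(2nz)$ be the Jacobi theta functions, write $\vartheta_j=\vartheta_j(0|q)$, and let the Jacobi elliptic functions with nome $q$ be the meromorphic functions of $u\in\mathbb C$ given, with $z=u/\vartheta_3^2$ (and wherever the values $\vartheta_j$ in denominators are nonzero), by $$\mathrm{sn}(q,u)=\frac{\vartheta_3}{\vartheta_2}\frac{\vartheta_1(z|q)}{\vartheta_4(z|q)},\quad \mathrm{cn}(q,u)=\frac{\vartheta_4}{\vartheta_2}\frac{\vartheta_2(z|q)}{\vartheta_4(z|q)},\quad \mathrm{dn}(q,u)=\frac{\vartheta_4}{\vartheta_3}\frac{\vartheta_3(z|q)}{\vartheta_4(z|q)},\quad \mathrm{sd}=\frac{\mathrm{sn}}{\mathrm{dn}},\quad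 \mathrm{cd}=\frac{\mathrm{cn}}{\mathrm{dn}}.$$ (The choice of $q^{1/4}$ does not matter.) Let $r>0$ and $q=e^{-\pi\sqrt r}$. Let $k_r$ be the unique $k\in(0,1)$ with $K(\sqrt{1-k^2})/K(k)=\sqrt r$, where $K(k)=\int_0^{\pi/2}\frac{dt}{\sqrt{1-k^2\sin^2 t}}$ is the complete elliptic integral of the first kind, and let $k_r'=\sqrt{1-k_r^2}$. Then, as meromorphic functions of $u\in\mathbb C$, $$\mathrm{cn}(-q,u)=\mathrm{cd}\left(q,\frac{u}{k_r'}\right)\qquad\text{and}\qquad \mathrm{sn}(-q,u)=k_r'\,\mathrm{sd}\left(q,\frac{u}{k_r'}\right).$$ -/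

import Mathlib

noncomputable section

/-- The complete elliptic integral of the first kind
`K(k) = ∫₀^{π/2} dt / √(1 - k² sin² t)` as a function of the modulus `k`. -/
def ellipticK (k : ℝ) : ℝ :=
  ∫ t in (0 : ℝ)..(Real.pi / 2), 1 / Real.sqrt (1 - k ^ 2 * Real.sin t ^ 2)

/-- The complementary modulus `k' = √(1 - k²)`. -/
def complModulus (k : ℝ) : ℝ := Real.sqrt (1 - k ^ 2)

theorem ellipticK_radicand_pos {k : ℝ} (hk : k ∈ Set.Ioo (0 : ℝ) 1) (t : ℝ) :
    0 < 1 - k ^ 2 * Real.sin t ^ 2 := by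
  have h1 : k ^ 2 < 1 := by nlinarith [hk.1, hk.2]
  have h2 := Real.sin_sq_le_one t
  nlinarith [sq_nonneg k, sq_nonneg (Real.sin t)]

theorem ellipticK_integrand_continuous {k : ℝ} (hk : k ∈ Set.Ioo (0 : ℝ) 1) :
    Continuous fun t : ℝ => 1 / Real.sqrt (1 - k ^ 2 * Real.sin t ^ 2) := by
  refine continuous_const.div (by fun_prop) fun t => ?_
  exact (Real.sqrt_pos.2 (ellipticK_radicand_pos hk t)).ne'

theorem ellipticK_strictMonoOn : StrictMonoOn ellipticK (Set.Ioo (0 : ℝ) 1) := by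
  intro a ha b hb hab
  have hsq : a ^ 2 < b ^ 2 := by nlinarith [ha.1, hb.1]
  refine intervalIntegral.integral_lt_integral_of_continuousOn_of_le_of_exists_lt
    Real.pi_div_two_pos (ellipticK_integrand_continuous ha).continuousOn
    (ellipticK_integrand_continuous hb).continuousOn (fun t _ => ?_)
    ⟨Real.pi / 2, ⟨Real.pi_div_two_pos.le, le_rfl⟩, ?_⟩
  · refine one_div_le_one_div_of_le (Real.sqrt_pos.2 (ellipticK_radicand_pos hb t))
      (Real.sqrt_le_sqrt ?_)
    nlinarith [sq_nonneg (Real.sin t)]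
  · refine one_div_lt_one_div_of_lt (Real.sqrt_pos.2 (ellipticK_radicand_pos hb _))
      (Real.sqrt_lt_sqrt (ellipticK_radicand_pos hb _).le ?_)
    rw [Real.sin_pi_div_two]
    linarith

theorem ellipticK_pos {k : ℝ} (hk : k ∈ Set.Ioo (0 : ℝ) 1) : 0 < ellipticK k := by
  refine intervalIntegral.intervalIntegral_pos_of_pos
    ((ellipticK_integrand_continuous hk).intervalIntegrable _ _) (fun t => ?_)
    Real.pi_div_two_pos
  exact one_div_pos.2 (Real.sqrt_pos.2 (ellipticK_radicand_pos hk t))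

theorem ellipticK_continuousOn : ContinuousOn ellipticK (Set.Ioo (0 : ℝ) 1) := by
  intro a ha
  refine ContinuousAt.continuousWithinAt ?_
  obtain ⟨b, hab, hb1⟩ := exists_between ha.2
  have hb : b ∈ Set.Ioo (0 : ℝ) 1 := ⟨ha.1.trans hab, hb1⟩
  have hev : ∀ᶠ x in nhds a, x ∈ Set.Ioo (0 : ℝ) b := Ioo_mem_nhds ha.1 hab
  refine intervalIntegral.continuousAt_of_dominated_interval
    (bound := fun t => 1 / Real.sqrt (1 - b ^ 2 * Real.sin t ^ 2)) ?_ ?_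
    ((ellipticK_integrand_continuous hb).intervalIntegrable _ _) ?_
  · filter_upwards [hev] with x hx
    exact (ellipticK_integrand_continuous ⟨hx.1, hx.2.trans hb1⟩).aestronglyMeasurable
  · filter_upwards [hev] with x hx
    refine Filter.Eventually.of_forall fun t _ => ?_
    have hxx : x ∈ Set.Ioo (0 : ℝ) 1 := ⟨hx.1, hx.2.trans hb1⟩
    rw [Real.norm_of_nonneg (by positivity)]
    refine one_div_le_one_div_of_le (Real.sqrt_pos.2 (ellipticK_radicand_pos hb t))
      (Real.sqrt_le_sqrt ?_)
    have : x ^ 2 ≤ b ^ 2 := by nlinarith [hx.1, hx.2]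
    nlinarith [sq_nonneg (Real.sin t)]
  · refine Filter.Eventually.of_forall fun t _ => ?_
    refine ContinuousAt.div continuousAt_const (by fun_prop) ?_
    exact (Real.sqrt_pos.2 (ellipticK_radicand_pos ha t)).ne'

theorem complModulus_mem {k : ℝ} (hk : k ∈ Set.Ioo (0 : ℝ) 1) :
    complModulus k ∈ Set.Ioo (0 : ℝ) 1 := by
  have h1 : k ^ 2 < 1 := by nlinarith [hk.1, hk.2]
  have h2 : 0 < k ^ 2 := by nlinarith [hk.1]
  refine ⟨Real.sqrt_pos.2 (by linarith), ?_⟩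
  rw [complModulus, Real.sqrt_lt' one_pos]
  linarith

theorem complModulus_sq {k : ℝ} (hk : k ∈ Set.Ioo (0 : ℝ) 1) :
    complModulus k ^ 2 = 1 - k ^ 2 :=
  Real.sq_sqrt (by nlinarith [hk.1, hk.2])

theorem complModulus_complModulus {k : ℝ} (hk : k ∈ Set.Ioo (0 : ℝ) 1) :
    complModulus (complModulus k) = k := by
  rw [complModulus, complModulus_sq hk, sub_sub_cancel, Real.sqrt_sq hk.1.le]

theorem complModulus_lt {a b : ℝ} (ha : a ∈ Set.Ioo (0 : ℝ) 1) (hb : b ∈ Set.Ioo (0 : ℝ) 1)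
    (hab : a < b) : complModulus b < complModulus a :=
  Real.sqrt_lt_sqrt (by nlinarith [hb.1, hb.2]) (by nlinarith [ha.1, hb.1])

theorem ellipticK_le_pi {k : ℝ} (hk : k ∈ Set.Ioo (0 : ℝ) 1) (hk2 : k ≤ 1 / 2) :
    ellipticK k ≤ Real.pi := by
  have h : ellipticK k ≤ ∫ _ in (0 : ℝ)..(Real.pi / 2), (2 : ℝ) := by
    refine intervalIntegral.integral_mono_on Real.pi_div_two_pos.le
      ((ellipticK_integrand_continuous hk).intervalIntegrable _ _) (by simp) fun t _ => ?_
    have h1 : (1 / 2 : ℝ) ≤ Real.sqrt (1 - k ^ 2 * Real.sin t ^ 2) := by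
      refine Real.le_sqrt_of_sq_le ?_
      have h2 : k ^ 2 ≤ 1 / 4 := by nlinarith [hk.1]
      nlinarith [Real.sin_sq_le_one t, sq_nonneg (Real.sin t), sq_nonneg k]
    calc 1 / Real.sqrt (1 - k ^ 2 * Real.sin t ^ 2) ≤ 1 / (1 / 2) :=
          one_div_le_one_div_of_le (by norm_num) h1
      _ = 2 := by norm_num
  rw [intervalIntegral.integral_const, smul_eq_mul] at h
  linarith

theorem neg_log_le_ellipticK {k : ℝ} (hk : k ∈ Set.Ioo (0 : ℝ) 1) :
    -Real.log k ≤ ellipticK (complModulus k) := by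
  have hpi := Real.pi_div_two_pos
  have h : ∫ t in (0 : ℝ)..(Real.pi / 2), ((Real.pi / 2 + k) - t)⁻¹ ≤
      ellipticK (complModulus k) := by
    refine intervalIntegral.integral_mono_on hpi.le ?_
      ((ellipticK_integrand_continuous (complModulus_mem hk)).intervalIntegrable _ _)
      fun t ht => ?_
    · refine ContinuousOn.intervalIntegrable (ContinuousOn.inv₀ (by fun_prop) fun t ht => ?_)
      rw [Set.uIcc_of_le hpi.le] at ht
      linarith [ht.2, hk.1]
    · have hx : 0 ≤ Real.pi / 2 - t := by linarith [ht.2]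
      have hkp := hk.1
      have hc0 : 0 ≤ Real.cos t := Real.cos_nonneg_of_mem_Icc ⟨by linarith [ht.1], ht.2⟩
      have hc : Real.cos t ≤ Real.pi / 2 - t := by
        rw [← Real.sin_pi_div_two_sub]
        exact Real.sin_le hx
      rw [← one_div]
      refine one_div_le_one_div_of_le
        (Real.sqrt_pos.2 (ellipticK_radicand_pos (complModulus_mem hk) t))
        ((Real.sqrt_le_left (by linarith)).2 ?_)
      rw [complModulus_sq hk]
      nlinarith [Real.sin_sq_add_cos_sq t, mul_nonneg hx hkp.le,
        mul_nonneg (sq_nonneg k) (sq_nonneg (Real.cos t))]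
  rw [intervalIntegral.integral_comp_sub_left (fun x => x⁻¹) (Real.pi / 2 + k),
    integral_inv_of_pos (by linarith [hk.1]) (by linarith [hk.1])] at h
  refine le_trans ?_ h
  rw [← Real.log_inv]
  refine Real.log_le_log (inv_pos.2 hk.1) ?_
  rw [inv_eq_one_div, sub_zero, add_sub_cancel_left]
  exact div_le_div_of_nonneg_right (by linarith [Real.pi_gt_three, hk.1]) hk.1.le

theorem exists_le_ellipticK_ratio (y : ℝ) :
    ∃ k ∈ Set.Ioo (0 : ℝ) 1, y ≤ ellipticK (complModulus k) / ellipticK k := by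
  have hk : min (1 / 2) (Real.exp (-(Real.pi * |y|))) ∈ Set.Ioo (0 : ℝ) 1 :=
    ⟨lt_min (by norm_num) (Real.exp_pos _), (min_le_left _ _).trans_lt (by norm_num)⟩
  refine ⟨_, hk, (le_abs_self y).trans ((le_div_iff₀ (ellipticK_pos hk)).2 ?_)⟩
  refine le_trans ?_ (neg_log_le_ellipticK hk)
  have h1 := ellipticK_le_pi hk (min_le_left _ _)
  have h2 := Real.log_le_log hk.1 (min_le_right _ _)
  rw [Real.log_exp] at h2
  nlinarith [abs_nonneg y]

/-- For every `r > 0` there is exactly one modulus `0 < k < 1` with `K(k') / K(k) = √r`. -/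
theorem existsUnique_singularModulus (r : ℝ) (hr : 0 < r) :
    ∃! k : ℝ, k ∈ Set.Ioo (0 : ℝ) 1 ∧
      ellipticK (complModulus k) / ellipticK k = Real.sqrt r := by
  have hs : 0 < Real.sqrt r := Real.sqrt_pos.2 hr
  obtain ⟨a, ha, hya⟩ := exists_le_ellipticK_ratio (Real.sqrt r)
  obtain ⟨b, hb, hyb⟩ := exists_le_ellipticK_ratio (Real.sqrt r)⁻¹
  have hc : ContinuousOn (fun k => ellipticK (complModulus k) / ellipticK k)
      (Set.Ioo (0 : ℝ) 1) := by
    refine ContinuousOn.div (ellipticK_continuousOn.comp ?_ fun k hk => complModulus_mem hk)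
      ellipticK_continuousOn fun k hk => (ellipticK_pos hk).ne'
    unfold complModulus
    fun_prop
  have hb' : ellipticK (complModulus (complModulus b)) / ellipticK (complModulus b) ≤
      Real.sqrt r := by
    rw [complModulus_complModulus hb, ← inv_div]
    exact inv_le_of_inv_le₀ hs hyb
  obtain ⟨k, hk, hkr⟩ := isPreconnected_Ioo.intermediate_value (complModulus_mem hb) ha hc
    ⟨hb', hya⟩
  refine ⟨k, ⟨hk, hkr⟩, ?_⟩
  have key : ∀ x ∈ Set.Ioo (0 : ℝ) 1, ∀ y ∈ Set.Ioo (0 : ℝ) 1, x < y →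
      ellipticK (complModulus y) / ellipticK y < ellipticK (complModulus x) / ellipticK x := by
    intro x hx y hy hxy
    exact div_lt_div₀ (ellipticK_strictMonoOn (complModulus_mem hy) (complModulus_mem hx)
      (complModulus_lt hx hy hxy)) (ellipticK_strictMonoOn hx hy hxy).le
      (ellipticK_pos (complModulus_mem hx)).le (ellipticK_pos hx)
  rintro l ⟨hl, hlr⟩
  simp only at hkr
  rcases lt_trichotomy l k with h | h | h
  · have := key l hl k hk h
    rw [hkr, hlr] at this
    exact absurd this (lt_irrefl _)
  · exact h
  · have := key k hk l hl h
    rw [hkr, hlr] at this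
    exact absurd this (lt_irrefl _)

/-- For `r > 0`, the modulus `k_r`: the unique `0 < k < 1` with `K(k') / K(k) = √r`, that is,
the modulus with nome `e^{-π√r}`. -/
def singularModulus (r : ℝ) : ℝ :=
  if hr : 0 < r then (existsUnique_singularModulus r hr).choose else 0

theorem singularModulus_spec (r : ℝ) (hr : 0 < r) :
    singularModulus r ∈ Set.Ioo (0 : ℝ) 1 ∧
      ellipticK (complModulus (singularModulus r)) / ellipticK (singularModulus r) =
        Real.sqrt r := by
  rw [singularModulus, dif_pos hr]
  exact (existsUnique_singularModulus r hr).choose_spec.1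

/-! The four Jacobi theta functions `ϑ_j(z | q)` with nome `q`, `‖q‖ < 1`. The root `q^{1/4}` in
`ϑ₁`, `ϑ₂` is the principal one; in the elliptic functions below it occurs only through quotients
of `ϑ₁`, `ϑ₂`, so that for `q ≠ 0` they do not depend on this choice. -/

/-- `ϑ₁(z | q) = 2 q^{1/4} ∑_{n ≥ 0} (-1)ⁿ q^{n(n+1)} sin((2n+1)z)`. -/
def theta1 (q z : ℂ) : ℂ :=
  2 * q ^ (1 / 4 : ℂ) *
    ∑' n : ℕ, (-1) ^ n * q ^ (n * (n + 1)) * Complex.sin ((2 * n + 1) * z)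

/-- `ϑ₂(z | q) = 2 q^{1/4} ∑_{n ≥ 0} q^{n(n+1)} cos((2n+1)z)`. -/
def theta2 (q z : ℂ) : ℂ :=
  2 * q ^ (1 / 4 : ℂ) * ∑' n : ℕ, q ^ (n * (n + 1)) * Complex.cos ((2 * n + 1) * z)

/-- `ϑ₃(z | q) = 1 + 2 ∑_{n ≥ 1} q^{n²} cos(2nz)`. -/
def theta3 (q z : ℂ) : ℂ :=
  1 + 2 * ∑' n : ℕ, q ^ ((n + 1) ^ 2) * Complex.cos (2 * (n + 1) * z)

/-- `ϑ₄(z | q) = 1 + 2 ∑_{n ≥ 1} (-1)ⁿ q^{n²} cos(2nz)`. -/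
def theta4 (q z : ℂ) : ℂ :=
  1 + 2 * ∑' n : ℕ, (-1) ^ (n + 1) * q ^ ((n + 1) ^ 2) * Complex.cos (2 * (n + 1) * z)

/-- The theta variable `z = u / ϑ₃(0 | q)²` that belongs to the argument `u` of the elliptic
functions with nome `q` (it is `π u / (2K)`). -/
def thetaArg (q u : ℂ) : ℂ := u / theta3 q 0 ^ 2

/-- The Jacobi elliptic function `sn(q, u)` with nome `q`, where `0 < ‖q‖ < 1`. -/
def jacobiSn (q u : ℂ) : ℂ :=
  theta3 q 0 / theta2 q 0 * (theta1 q (thetaArg q u) / theta4 q (thetaArg q u))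

/-- The Jacobi elliptic function `cn(q, u)` with nome `q`, where `0 < ‖q‖ < 1`. -/
def jacobiCn (q u : ℂ) : ℂ :=
  theta4 q 0 / theta2 q 0 * (theta2 q (thetaArg q u) / theta4 q (thetaArg q u))

/-- The Jacobi elliptic function `dn(q, u)` with nome `q`, where `0 < ‖q‖ < 1`. -/
def jacobiDn (q u : ℂ) : ℂ :=
  theta4 q 0 / theta3 q 0 * (theta3 q (thetaArg q u) / theta4 q (thetaArg q u))

/-- The Jacobi elliptic function `sd = sn / dn`, in the form without the factor `ϑ₄(z | q)` that
`sn` and `dn` have in common in the denominator, so that it also has its right value at the common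
poles of `sn` and `dn`. -/
def jacobiSd (q u : ℂ) : ℂ :=
  theta3 q 0 ^ 2 / (theta2 q 0 * theta4 q 0) *
    (theta1 q (thetaArg q u) / theta3 q (thetaArg q u))

/-- The Jacobi elliptic function `cd = cn / dn`, in the form without the factor `ϑ₄(z | q)` that
`cn` and `dn` have in common in the denominator, so that it also has its right value at the common
poles of `cn` and `dn`. -/
def jacobiCd (q u : ℂ) : ℂ :=
  theta3 q 0 / theta2 q 0 * (theta2 q (thetaArg q u) / theta3 q (thetaArg q u))

theorem jacobiSd_eq_div (q u : ℂ) (h : theta4 q (thetaArg q u) ≠ 0) :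
    jacobiSd q u = jacobiSn q u / jacobiDn q u := by
  unfold jacobiSd jacobiSn jacobiDn
  field_simp

theorem jacobiCd_eq_div (q u : ℂ) (h : theta4 q (thetaArg q u) ≠ 0) (h0 : theta4 q 0 ≠ 0) :
    jacobiCd q u = jacobiCn q u / jacobiDn q u := by
  unfold jacobiCd jacobiCn jacobiDn
  field_simp

end

/-! Replacing `q` by `-q` exchanges ϑ₃ and ϑ₄ and leaves quotients of ϑ₁, ϑ₂ unchanged, since `n²`
has the parity of `n` and `n(n+1)` is even. Both identities then compare the same theta quotients,
and they match once k_r' = ϑ₄²/ϑ₃² at nome e^{-π√r}. That equality (`complModulus_singularModulus`)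
is the real content.

It is proved by Gauss' arithmetic-geometric mean. With nome e^{-πs}, passing from `s` to `2s`
replaces (ϑ₃², ϑ₄²) by its arithmetic and geometric means, which preserve Gauss' integral
(`gaussIntegral_agm`). As s → ∞ the pair tends to (1, 1), so the integral is π/2, and K = (π/2)ϑ₃²
at the modulus complementary to ϑ₄²/ϑ₃². By Jacobi's quartic identity and Poisson summation,
complementing this modulus is the inversion s ↦ 1/s, under which ϑ₃² gains the factor `s`. Hence
K'/K = s, and uniqueness of the singular modulus finishes the argument. -/

noncomputable section

/-! ### Theta constants: duplication formulas and the quartic identity -/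

/-- The theta constant `∑ exp (-π s n²)` over the integers. -/
def thetaConst (s : ℝ) : ℝ := ∑' n : ℤ, Real.exp (-Real.pi * s * (n : ℝ) ^ 2)

/-- The alternating theta constant `∑ (-1)ⁿ exp (-π s n²)` over the integers. -/
def thetaConstAlt (s : ℝ) : ℝ := ∑' n : ℤ, (-1) ^ n * Real.exp (-Real.pi * s * (n : ℝ) ^ 2)

/-- The theta constant `∑ exp (-π s (n + 1/2)²)` over the half-integers. -/
def thetaConstHalf (s : ℝ) : ℝ := ∑' n : ℤ, Real.exp (-Real.pi * s * (n + 1 / 2 : ℝ) ^ 2)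

theorem summable_exp_neg_pi_mul_add_sq {s : ℝ} (hs : 0 < s) (c : ℝ) :
    Summable fun n : ℤ => Real.exp (-Real.pi * s * (n + c : ℝ) ^ 2) := by
  have h := ((summable_jacobiTheta₂_term_iff (s * c * Complex.I) (s * Complex.I)).2
    (by simpa using hs)).norm.mul_left (Real.exp (-Real.pi * s * c ^ 2))
  refine h.congr fun n => ?_
  rw [norm_jacobiTheta₂_term, ← Real.exp_add]
  congr 1
  simp
  ring

theorem summable_exp_neg_pi_mul_sq {s : ℝ} (hs : 0 < s) :
    Summable fun n : ℤ => Real.exp (-Real.pi * s * (n : ℝ) ^ 2) := by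
  simpa using summable_exp_neg_pi_mul_add_sq hs 0

theorem summable_alternating_exp_neg_pi_mul_sq {s : ℝ} (hs : 0 < s) :
    Summable fun n : ℤ => (-1) ^ n * Real.exp (-Real.pi * s * (n : ℝ) ^ 2) := by
  refine Summable.of_norm ((summable_exp_neg_pi_mul_sq hs).congr fun n => ?_)
  simp

/-- A pair of integers is either `(j + k, j - k)` or `(j + k + 1, j - k)`. -/
def intPairParityEquiv : (ℤ × ℤ) ⊕ (ℤ × ℤ) ≃ ℤ × ℤ where
  toFun := Sum.elim (fun p => (p.1 + p.2, p.1 - p.2)) fun p => (p.1 + p.2 + 1, p.1 - p.2)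
  invFun p := if (p.1 + p.2) % 2 = 0 then Sum.inl ((p.1 + p.2) / 2, (p.1 - p.2) / 2)
    else Sum.inr ((p.1 + p.2 - 1) / 2, (p.1 - p.2 - 1) / 2)
  left_inv := by
    rintro (⟨j, k⟩ | ⟨j, k⟩)
    · have h : (j + k + (j - k)) % 2 = 0 := by omega
      simp only [Sum.elim_inl, h, if_true, Sum.inl.injEq, Prod.mk.injEq]
      omega
    · have h : ¬ (j + k + 1 + (j - k)) % 2 = 0 := by omega
      simp only [Sum.elim_inr, h, if_false, Sum.inr.injEq, Prod.mk.injEq]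
      omega
  right_inv := by
    rintro ⟨m, n⟩
    by_cases h : (m + n) % 2 = 0
    · simp only [h, if_true, Sum.elim_inl, Prod.mk.injEq]
      omega
    · simp only [h, if_false, Sum.elim_inr, Prod.mk.injEq]
      omega

/-- Source of all the duplication formulas: (j+k)² + (j-k)² = 2(j² + k²) and (j+k+1)² + (j-k)² =
2((j+1/2)² + (k+1/2)²), so within each parity class a product of Gaussians at `s` separates into
Gaussians at `2s`. -/
theorem tsum_mul_tsum_eq_add_tsum_parity {f g : ℤ → ℝ} (hf : Summable f) (hg : Summable g) :
    (∑' n, f n) * ∑' n, g n = (∑' p : ℤ × ℤ, f (p.1 + p.2) * g (p.1 - p.2)) +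
      ∑' p : ℤ × ℤ, f (p.1 + p.2 + 1) * g (p.1 - p.2) := by
  have hs := summable_mul_of_summable_norm hf.norm hg.norm
  rw [tsum_mul_tsum_of_summable_norm hf.norm hg.norm, ← intPairParityEquiv.tsum_eq]
  have hs' := intPairParityEquiv.summable_iff.2 hs
  exact Summable.tsum_sum (hs'.comp_injective Sum.inl_injective)
    (hs'.comp_injective Sum.inr_injective)

theorem neg_one_zpow_add_mul_sub (j k : ℤ) : (-1 : ℝ) ^ (j + k) * (-1) ^ (j - k) = 1 := by
  rw [← zpow_add₀ (by norm_num), show j + k + (j - k) = 2 * j by ring, zpow_mul]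
  simp

theorem neg_one_zpow_sub (j k : ℤ) : (-1 : ℝ) ^ (j - k) = (-1) ^ j * (-1) ^ k := by
  rw [zpow_sub₀ (by norm_num), div_eq_mul_inv, ← zpow_neg, ← inv_zpow', inv_neg, inv_one]

theorem tsum_mul_tsum_exp {s : ℝ} (hs : 0 < s) (c d : ℝ) :
    ∑' p : ℤ × ℤ, Real.exp (-Real.pi * s * (p.1 + c : ℝ) ^ 2) *
      Real.exp (-Real.pi * s * (p.2 + d : ℝ) ^ 2) =
    (∑' n : ℤ, Real.exp (-Real.pi * s * (n + c : ℝ) ^ 2)) *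
      ∑' n : ℤ, Real.exp (-Real.pi * s * (n + d : ℝ) ^ 2) :=
  (tsum_mul_tsum_of_summable_norm (summable_exp_neg_pi_mul_add_sq hs c).norm
    (summable_exp_neg_pi_mul_add_sq hs d).norm).symm

theorem thetaConst_sq {s : ℝ} (hs : 0 < s) :
    thetaConst s ^ 2 = thetaConst (2 * s) ^ 2 + thetaConstHalf (2 * s) ^ 2 := by
  have h2 : 0 < 2 * s := by linarith
  have hA := tsum_mul_tsum_exp h2 0 0
  simp only [add_zero] at hA
  rw [sq, sq, sq, thetaConst, thetaConst, thetaConstHalf, tsum_mul_tsum_eq_add_tsum_parity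
    (summable_exp_neg_pi_mul_sq hs) (summable_exp_neg_pi_mul_sq hs), ← hA,
    ← tsum_mul_tsum_exp h2 (1 / 2) (1 / 2)]
  congr 1 <;> refine tsum_congr fun p => ?_ <;> rw [← Real.exp_add, ← Real.exp_add] <;>
    congr 1 <;> push_cast <;> ring

theorem thetaConstAlt_sq {s : ℝ} (hs : 0 < s) :
    thetaConstAlt s ^ 2 = thetaConst (2 * s) ^ 2 - thetaConstHalf (2 * s) ^ 2 := by
  have h2 : 0 < 2 * s := by linarith
  have hA := tsum_mul_tsum_exp h2 0 0
  simp only [add_zero] at hA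
  rw [sq, sq, sq, thetaConst, thetaConstAlt, thetaConstHalf, tsum_mul_tsum_eq_add_tsum_parity
    (summable_alternating_exp_neg_pi_mul_sq hs) (summable_alternating_exp_neg_pi_mul_sq hs), ← hA,
    ← tsum_mul_tsum_exp h2 (1 / 2) (1 / 2), sub_eq_add_neg, ← tsum_neg]
  congr 1 <;> refine tsum_congr fun p => ?_
  · rw [mul_mul_mul_comm, neg_one_zpow_add_mul_sub, one_mul, ← Real.exp_add, ← Real.exp_add]
    congr 1
    push_cast
    ring
  · rw [mul_mul_mul_comm, zpow_add_one₀ (by norm_num), mul_right_comm ((-1) ^ _) (-1),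
      neg_one_zpow_add_mul_sub, one_mul, neg_one_mul, ← Real.exp_add, ← Real.exp_add]
    congr 2
    push_cast
    ring

/-- The reflection n ↦ -1-n preserves (n+1/2)² and flips the sign of the term. -/
theorem tsum_alternating_exp_half (s : ℝ) :
    ∑' n : ℤ, (-1) ^ n * Real.exp (-Real.pi * s * (n + 1 / 2 : ℝ) ^ 2) = 0 := by
  have h := (Equiv.subLeft (-1 : ℤ)).tsum_eq
    fun n : ℤ => (-1) ^ n * Real.exp (-Real.pi * s * (n + 1 / 2 : ℝ) ^ 2)
  have h' : ∀ n : ℤ, (-1 : ℝ) ^ (Equiv.subLeft (-1 : ℤ) n) *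
      Real.exp (-Real.pi * s * (((Equiv.subLeft (-1 : ℤ) n : ℤ) : ℝ) + 1 / 2 : ℝ) ^ 2) =
      -((-1) ^ n * Real.exp (-Real.pi * s * (n + 1 / 2 : ℝ) ^ 2)) := by
    intro n
    rw [Equiv.subLeft_apply, neg_one_zpow_sub, ← neg_mul]
    congr 1
    · simp
    · congr 1
      push_cast
      ring
  rw [tsum_congr h', tsum_neg] at h
  linarith

theorem thetaConst_mul_thetaConstAlt {s : ℝ} (hs : 0 < s) :
    thetaConst s * thetaConstAlt s = thetaConstAlt (2 * s) ^ 2 := by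
  have h2 : 0 < 2 * s := by linarith
  have hB := summable_alternating_exp_neg_pi_mul_sq h2
  have hH : Summable fun n : ℤ =>
      (-1) ^ n * Real.exp (-Real.pi * (2 * s) * (n + 1 / 2 : ℝ) ^ 2) := by
    refine Summable.of_norm ((summable_exp_neg_pi_mul_add_sq h2 (1 / 2)).congr fun n => ?_)
    simp
  have h0 := tsum_mul_tsum_of_summable_norm hH.norm hH.norm
  rw [tsum_alternating_exp_half, zero_mul] at h0
  -- The odd parity class factors as the square of the vanishing half-integer sum, so that zero is
  -- added to the right-hand side to match it.
  rw [← add_zero (thetaConstAlt (2 * s) ^ 2), h0]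
  clear h0
  rw [sq, thetaConst, thetaConstAlt, thetaConstAlt, tsum_mul_tsum_eq_add_tsum_parity
    (summable_exp_neg_pi_mul_sq hs) (summable_alternating_exp_neg_pi_mul_sq hs),
    tsum_mul_tsum_of_summable_norm hB.norm hB.norm]
  congr 1 <;> refine tsum_congr fun p => ?_ <;>
    rw [mul_mul_mul_comm, ← neg_one_zpow_sub, mul_left_comm, ← Real.exp_add, ← Real.exp_add] <;>
    congr 2 <;> push_cast <;> ring

theorem thetaConstHalf_sq {s : ℝ} (hs : 0 < s) :
    thetaConstHalf s ^ 2 = 2 * (thetaConst (2 * s) * thetaConstHalf (2 * s)) := by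
  have h2 : 0 < 2 * s := by linarith
  have h1 := tsum_mul_tsum_exp h2 (1 / 2) 0
  have h3 := tsum_mul_tsum_exp h2 1 (1 / 2)
  have h4 := (Equiv.addRight (1 : ℤ)).tsum_eq
    fun n : ℤ => Real.exp (-Real.pi * (2 * s) * (n : ℝ) ^ 2)
  simp only [Equiv.coe_addRight, Int.cast_add, Int.cast_one] at h4
  rw [h4] at h3
  simp only [add_zero] at h1
  rw [sq, two_mul, thetaConst, thetaConstHalf, thetaConstHalf, tsum_mul_tsum_eq_add_tsum_parity
    (summable_exp_neg_pi_mul_add_sq hs _) (summable_exp_neg_pi_mul_add_sq hs _)]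
  nth_rewrite 1 [mul_comm (tsum _)]
  rw [← h1, ← h3]
  congr 1 <;> refine tsum_congr fun p => ?_ <;> rw [← Real.exp_add, ← Real.exp_add] <;>
    congr 1 <;> push_cast <;> ring

/-- With A, H the integer and half-integer constants at `2s`, this is (A² + H²)² = (A² - H²)² +
(2AH)². -/
theorem thetaConst_pow_four {s : ℝ} (hs : 0 < s) :
    thetaConst s ^ 4 = thetaConstAlt s ^ 4 + thetaConstHalf s ^ 4 := by
  have h1 := thetaConst_sq hs
  have h2 := thetaConstAlt_sq hs
  have h3 := thetaConstHalf_sq hs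
  have e (x : ℝ) : x ^ 4 = (x ^ 2) ^ 2 := by ring
  rw [e (thetaConst s), e (thetaConstAlt s), e (thetaConstHalf s), h1, h2, h3]
  ring

theorem thetaConst_pos {s : ℝ} (hs : 0 < s) : 0 < thetaConst s :=
  (summable_exp_neg_pi_mul_sq hs).tsum_pos (fun _ => (Real.exp_pos _).le) 0 (Real.exp_pos _)

theorem thetaConstHalf_pos {s : ℝ} (hs : 0 < s) : 0 < thetaConstHalf s :=
  (summable_exp_neg_pi_mul_add_sq hs _).tsum_pos (fun _ => (Real.exp_pos _).le) 0 (Real.exp_pos _)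

/-! ### Inversion s ↦ 1/s and limits at infinity -/

theorem thetaConst_eq_inv {s : ℝ} (hs : 0 < s) :
    thetaConst s = 1 / Real.sqrt s * thetaConst s⁻¹ := by
  rw [thetaConst, Real.tsum_exp_neg_mul_int_sq hs, Real.sqrt_eq_rpow, thetaConst]
  simp only [div_eq_mul_inv]

theorem thetaConstAlt_eq_inv {s : ℝ} (hs : 0 < s) :
    thetaConstAlt s = 1 / Real.sqrt s * thetaConstHalf s⁻¹ := by
  -- The linear coefficient b = -i/2 makes exp(2πbn) = (-1)ⁿ, and in the dual sum shifts `n` by ib =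
  -- 1/2.
  have h := Complex.tsum_exp_neg_quadratic (a := s) (by simpa using hs) (-Complex.I / 2)
  rw [← Complex.ofReal_inj, thetaConstAlt, thetaConstHalf]
  push_cast
  convert h using 1
  · refine tsum_congr fun n => ?_
    rw [Complex.exp_add, mul_comm]
    congr 1
    rw [show 2 * (Real.pi : ℂ) * (-Complex.I / 2) * n = n * -(Real.pi * Complex.I) by ring,
      Complex.exp_int_mul, Complex.exp_neg, Complex.exp_pi_mul_I]
    norm_num
  · congr 1
    · rw [Real.sqrt_eq_rpow, Complex.ofReal_cpow hs.le]
      norm_num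
    · refine tsum_congr fun n => ?_
      congr 1
      rw [show Complex.I * (-Complex.I / 2) = 1 / 2 by
        linear_combination (-1 / 2 : ℂ) * Complex.I_mul_I]
      ring

/-- The series alternates; its dual has positive terms. -/
theorem thetaConstAlt_pos {s : ℝ} (hs : 0 < s) : 0 < thetaConstAlt s := by
  rw [thetaConstAlt_eq_inv hs]
  exact mul_pos (one_div_pos.2 (Real.sqrt_pos.2 hs)) (thetaConstHalf_pos (inv_pos.2 hs))

/-- Only the term n = 0 survives; for s ≥ 1 the series is dominated by the one at s = 1. -/
theorem tendsto_mul_exp_neg_pi_mul_sq (ε : ℤ → ℝ) (hε0 : ε 0 = 1) (hε : ∀ n, |ε n| = 1) :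
    Filter.Tendsto (fun s : ℝ => ∑' n : ℤ, ε n * Real.exp (-Real.pi * s * (n : ℝ) ^ 2))
      Filter.atTop (nhds 1) := by
  rw [← tsum_ite_eq (0 : ℤ) fun _ => (1 : ℝ)]
  refine tendsto_tsum_of_dominated_convergence (summable_exp_neg_pi_mul_sq one_pos)
    (fun n => ?_) ?_
  · rcases eq_or_ne n 0 with rfl | hn
    · simp [hε0]
    · simp only [hn, if_false]
      have hn' : 0 < Real.pi * (n : ℝ) ^ 2 := by positivity
      have h := (Real.tendsto_exp_neg_atTop_nhds_zero.comp
        (Filter.tendsto_id.const_mul_atTop hn')).const_mul (ε n)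
      rw [mul_zero] at h
      refine h.congr fun s => ?_
      simp only [Function.comp, id]
      congr 2
      ring
  · filter_upwards [Filter.eventually_ge_atTop 1] with s hs n
    rw [norm_mul, Real.norm_eq_abs, hε, one_mul, Real.norm_of_nonneg (Real.exp_pos _).le]
    refine Real.exp_le_exp.2 ?_
    nlinarith [mul_nonneg Real.pi_pos.le (sq_nonneg (n : ℝ))]

theorem tendsto_thetaConst : Filter.Tendsto thetaConst Filter.atTop (nhds 1) := by
  have h := tendsto_mul_exp_neg_pi_mul_sq (fun _ => 1) rfl (by simp)
  simp only [one_mul] at h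
  exact h

theorem tendsto_thetaConstAlt : Filter.Tendsto thetaConstAlt Filter.atTop (nhds 1) :=
  tendsto_mul_exp_neg_pi_mul_sq (fun n => (-1) ^ n) (by simp) (by simp)

/-! ### Gauss' integral and its invariance under the arithmetic-geometric mean -/

/-- Gauss' integral `∫₀^{π/2} dt / √(a² cos² t + b² sin² t)`. -/
def gaussIntegral (a b : ℝ) : ℝ :=
  ∫ t in (0 : ℝ)..(Real.pi / 2), 1 / Real.sqrt (a ^ 2 * Real.cos t ^ 2 + b ^ 2 * Real.sin t ^ 2)

theorem mul_cos_sq_add_mul_sin_sq_pos {a b : ℝ} (ha : 0 < a) (hb : 0 < b) (t : ℝ) :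
    0 < a * Real.cos t ^ 2 + b * Real.sin t ^ 2 := by
  rcases eq_or_ne (Real.cos t) 0 with h | h
  · have := Real.sin_sq_add_cos_sq t
    rw [h] at this ⊢
    nlinarith
  · have := mul_pos ha (sq_pos_of_ne_zero h)
    have := mul_nonneg hb.le (sq_nonneg (Real.sin t))
    linarith

theorem gaussIntegrand_continuous {a b : ℝ} (ha : 0 < a) (hb : 0 < b) :
    Continuous fun t : ℝ => 1 / Real.sqrt (a ^ 2 * Real.cos t ^ 2 + b ^ 2 * Real.sin t ^ 2) :=
  continuous_const.div (by fun_prop) fun t => (Real.sqrt_pos.2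
    (mul_cos_sq_add_mul_sin_sq_pos (pow_pos ha 2) (pow_pos hb 2) t)).ne'

theorem gaussIntegral_self_one : gaussIntegral 1 1 = Real.pi / 2 := by
  simp [gaussIntegral, Real.cos_sq_add_sin_sq]

theorem integral_zero_pi_gaussIntegrand {a b : ℝ} (ha : 0 < a) (hb : 0 < b) :
    ∫ t in (0 : ℝ)..Real.pi, 1 / Real.sqrt (a ^ 2 * Real.cos t ^ 2 + b ^ 2 * Real.sin t ^ 2) =
      2 * gaussIntegral a b := by
  have hc := gaussIntegrand_continuous ha hb
  rw [← intervalIntegral.integral_add_adjacent_intervals (b := Real.pi / 2)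
    (hc.intervalIntegrable _ _) (hc.intervalIntegrable _ _), two_mul, gaussIntegral]
  congr 1
  have h := intervalIntegral.integral_comp_sub_left (a := 0) (b := Real.pi / 2)
    (fun t => 1 / Real.sqrt (a ^ 2 * Real.cos t ^ 2 + b ^ 2 * Real.sin t ^ 2)) Real.pi
  rw [sub_zero, show Real.pi - Real.pi / 2 = Real.pi / 2 by ring] at h
  rw [← h]
  simp only [Real.cos_pi_sub, Real.sin_pi_sub, neg_sq]

/-- The change of variables in Gauss' transformation. -/
def gaussAngle (a b t : ℝ) : ℝ :=
  2 * t - Real.arctan ((a - b) * (Real.sin t * Real.cos t) /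
    (a * Real.cos t ^ 2 + b * Real.sin t ^ 2))

/-- Both sides are |a cos t + i b sin t|², the left one after multiplication by e^{-it}. So
`gaussAngle` is t + arg(a cos t + i b sin t), which yields its sine and cosine. -/
theorem gaussAngle_radicand {a b : ℝ} (t : ℝ) :
    (a * Real.cos t ^ 2 + b * Real.sin t ^ 2) ^ 2 + ((a - b) * (Real.sin t * Real.cos t)) ^ 2 =
      a ^ 2 * Real.cos t ^ 2 + b ^ 2 * Real.sin t ^ 2 := by
  linear_combination (a ^ 2 * Real.cos t ^ 2 + b ^ 2 * Real.sin t ^ 2) * Real.sin_sq_add_cos_sq t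

theorem hasDerivAt_gaussAngle {a b : ℝ} (ha : 0 < a) (hb : 0 < b) (t : ℝ) :
    HasDerivAt (gaussAngle a b) ((a + b) * (a * Real.cos t ^ 2 + b * Real.sin t ^ 2) /
      (a ^ 2 * Real.cos t ^ 2 + b ^ 2 * Real.sin t ^ 2)) t := by
  have hD := mul_cos_sq_add_mul_sin_sq_pos ha hb t
  have hE := mul_cos_sq_add_mul_sin_sq_pos (pow_pos ha 2) (pow_pos hb 2) t
  have hR := gaussAngle_radicand (a := a) (b := b) t
  have hcs := Real.sin_sq_add_cos_sq t
  have hN : HasDerivAt (fun t => (a - b) * (Real.sin t * Real.cos t))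
      ((a - b) * (Real.cos t ^ 2 - Real.sin t ^ 2)) t :=
    (((Real.hasDerivAt_sin t).mul (Real.hasDerivAt_cos t)).const_mul (a - b)).congr_deriv (by ring)
  have hD' : HasDerivAt (fun t => a * Real.cos t ^ 2 + b * Real.sin t ^ 2)
      (-2 * (a - b) * (Real.sin t * Real.cos t)) t :=
    ((((Real.hasDerivAt_cos t).pow 2).const_mul a).add
      (((Real.hasDerivAt_sin t).pow 2).const_mul b)).congr_deriv (by push_cast; ring)
  refine (((hasDerivAt_id t).const_mul 2).sub (hN.div hD' hD.ne').arctan).congr_deriv ?_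
  have e : 1 + ((a - b) * (Real.sin t * Real.cos t) /
      (a * Real.cos t ^ 2 + b * Real.sin t ^ 2)) ^ 2 =
      (a ^ 2 * Real.cos t ^ 2 + b ^ 2 * Real.sin t ^ 2) /
        (a * Real.cos t ^ 2 + b * Real.sin t ^ 2) ^ 2 := by
    rw [← hR]
    field_simp
  simp only [Pi.div_apply]
  rw [e, one_div_div, div_mul_div_cancel₀' (pow_pos hD 2).ne', eq_div_iff hE.ne', sub_mul,
    div_mul_cancel₀ _ hE.ne']
  linear_combination (-(a - b) * (a * Real.cos t ^ 2 - b * Real.sin t ^ 2)) * hcs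

theorem sqrt_one_add_gaussAngle_tan_sq {a b : ℝ} (ha : 0 < a) (hb : 0 < b) (t : ℝ) :
    Real.sqrt (1 + ((a - b) * (Real.sin t * Real.cos t) /
      (a * Real.cos t ^ 2 + b * Real.sin t ^ 2)) ^ 2) =
      Real.sqrt (a ^ 2 * Real.cos t ^ 2 + b ^ 2 * Real.sin t ^ 2) /
        (a * Real.cos t ^ 2 + b * Real.sin t ^ 2) := by
  have hD := mul_cos_sq_add_mul_sin_sq_pos ha hb t
  have hE := mul_cos_sq_add_mul_sin_sq_pos (pow_pos ha 2) (pow_pos hb 2) t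
  rw [eq_div_iff hD.ne', ← Real.sqrt_sq hD.le, ← Real.sqrt_mul (by positivity), Real.sqrt_sq hD.le,
    ← gaussAngle_radicand]
  congr 1
  field_simp

theorem cos_gaussAngle {a b : ℝ} (ha : 0 < a) (hb : 0 < b) (t : ℝ) :
    Real.cos (gaussAngle a b t) = (a * Real.cos t ^ 2 - b * Real.sin t ^ 2) /
      Real.sqrt (a ^ 2 * Real.cos t ^ 2 + b ^ 2 * Real.sin t ^ 2) := by
  have hD := mul_cos_sq_add_mul_sin_sq_pos ha hb t
  have hS := Real.sqrt_pos.2 (mul_cos_sq_add_mul_sin_sq_pos (pow_pos ha 2) (pow_pos hb 2) t)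
  rw [gaussAngle, Real.cos_sub, Real.cos_arctan, Real.sin_arctan, Real.cos_two_mul,
    Real.sin_two_mul, sqrt_one_add_gaussAngle_tan_sq ha hb, one_div_div,
    div_div_div_cancel_right₀ hD.ne', eq_div_iff hS.ne', add_mul, mul_assoc,
    div_mul_cancel₀ _ hS.ne', mul_assoc (2 * _ * _), div_mul_cancel₀ _ hS.ne']
  linear_combination (2 * a * Real.cos t ^ 2) * Real.sin_sq_add_cos_sq t

theorem sin_gaussAngle {a b : ℝ} (ha : 0 < a) (hb : 0 < b) (t : ℝ) :
    Real.sin (gaussAngle a b t) = (a + b) * (Real.sin t * Real.cos t) /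
      Real.sqrt (a ^ 2 * Real.cos t ^ 2 + b ^ 2 * Real.sin t ^ 2) := by
  have hD := mul_cos_sq_add_mul_sin_sq_pos ha hb t
  have hS := Real.sqrt_pos.2 (mul_cos_sq_add_mul_sin_sq_pos (pow_pos ha 2) (pow_pos hb 2) t)
  rw [gaussAngle, Real.sin_sub, Real.cos_arctan, Real.sin_arctan, Real.cos_two_mul,
    Real.sin_two_mul, sqrt_one_add_gaussAngle_tan_sq ha hb, one_div_div,
    div_div_div_cancel_right₀ hD.ne', eq_div_iff hS.ne', sub_mul, mul_assoc (2 * _ * _),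
    div_mul_cancel₀ _ hS.ne', mul_assoc (_ - _), div_mul_cancel₀ _ hS.ne']
  linear_combination (2 * b * (Real.sin t * Real.cos t)) * Real.sin_sq_add_cos_sq t

/-- Rests on (a cos² t - b sin² t)² + 4ab sin² t cos² t = (a cos² t + b sin² t)². -/
theorem gaussAngle_radicand_comp {a b : ℝ} (ha : 0 < a) (hb : 0 < b) (t : ℝ) :
    Real.sqrt (((a + b) / 2) ^ 2 * Real.cos (gaussAngle a b t) ^ 2 +
      Real.sqrt (a * b) ^ 2 * Real.sin (gaussAngle a b t) ^ 2) =
    (a + b) / 2 * (a * Real.cos t ^ 2 + b * Real.sin t ^ 2) /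
      Real.sqrt (a ^ 2 * Real.cos t ^ 2 + b ^ 2 * Real.sin t ^ 2) := by
  have hD := mul_cos_sq_add_mul_sin_sq_pos ha hb t
  rw [Real.sq_sqrt (mul_pos ha hb).le, cos_gaussAngle ha hb, sin_gaussAngle ha hb,
    ← Real.sqrt_sq (by positivity : 0 ≤ (a + b) / 2 * (a * Real.cos t ^ 2 + b * Real.sin t ^ 2) /
      Real.sqrt (a ^ 2 * Real.cos t ^ 2 + b ^ 2 * Real.sin t ^ 2))]
  congr 1
  ring

/-- Under φ = `gaussAngle a b t` the integrand of the means, times φ', is twice the original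
integrand. As `t` runs over [0, π/2], φ goes from 0 to π, which also doubles the integral of the
means. -/
theorem gaussIntegral_agm {a b : ℝ} (ha : 0 < a) (hb : 0 < b) :
    gaussIntegral a b = gaussIntegral ((a + b) / 2) (Real.sqrt (a * b)) := by
  have ha' : 0 < (a + b) / 2 := by positivity
  have hb' : 0 < Real.sqrt (a * b) := by positivity
  have hE := mul_cos_sq_add_mul_sin_sq_pos (pow_pos ha 2) (pow_pos hb 2)
  have h := intervalIntegral.integral_comp_mul_deriv (a := 0) (b := Real.pi / 2)
    (fun t _ => hasDerivAt_gaussAngle ha hb t)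
    (Continuous.continuousOn (Continuous.div (by fun_prop) (by fun_prop) fun t => (hE t).ne'))
    (gaussIntegrand_continuous ha' hb')
  have h0 : gaussAngle a b 0 = 0 := by simp [gaussAngle]
  have h1 : gaussAngle a b (Real.pi / 2) = Real.pi := by simp [gaussAngle]; ring
  rw [h0, h1, integral_zero_pi_gaussIntegrand ha' hb'] at h
  have h2 : 2 * gaussIntegral a b = 2 * gaussIntegral ((a + b) / 2) (Real.sqrt (a * b)) := by
    rw [← h, gaussIntegral, ← intervalIntegral.integral_const_mul]
    refine intervalIntegral.integral_congr fun t _ => ?_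
    have hD := mul_cos_sq_add_mul_sin_sq_pos ha hb t
    have hS := Real.sqrt_pos.2 (hE t)
    have hS2 := Real.sq_sqrt (hE t).le
    simp only [Function.comp]
    rw [gaussAngle_radicand_comp ha hb]
    -- The third occurrence is the denominator of φ'; as a square of the root it cancels.
    nth_rewrite 3 [← hS2]
    field_simp
  linarith

theorem continuousAt_gaussIntegral_one :
    ContinuousAt (fun p : ℝ × ℝ => gaussIntegral p.1 p.2) (1, 1) := by
  have hev : ∀ᶠ p : ℝ × ℝ in nhds (1, 1), 1 / 2 < p.1 ∧ 1 / 2 < p.2 :=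
    (continuousAt_fst.eventually (lt_mem_nhds (by norm_num))).and
      (continuousAt_snd.eventually (lt_mem_nhds (by norm_num)))
  refine intervalIntegral.continuousAt_of_dominated_interval (bound := fun _ => 2) ?_ ?_
    (by simp) ?_
  · filter_upwards [hev] with p hp
    exact (gaussIntegrand_continuous (by linarith [hp.1])
      (by linarith [hp.2])).aestronglyMeasurable
  · filter_upwards [hev] with p hp
    refine Filter.Eventually.of_forall fun t _ => ?_
    rw [Real.norm_of_nonneg (by positivity)]
    have h : 1 / 2 ≤ Real.sqrt (p.1 ^ 2 * Real.cos t ^ 2 + p.2 ^ 2 * Real.sin t ^ 2) := by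
      refine Real.le_sqrt_of_sq_le ?_
      have h1 : 1 / 4 ≤ p.1 ^ 2 := by nlinarith [hp.1]
      have h2 : 1 / 4 ≤ p.2 ^ 2 := by nlinarith [hp.2]
      nlinarith [Real.sin_sq_add_cos_sq t, sq_nonneg (Real.cos t), sq_nonneg (Real.sin t)]
    calc _ ≤ 1 / (1 / 2 : ℝ) := one_div_le_one_div_of_le (by norm_num) h
      _ = 2 := by norm_num
  · refine Filter.Eventually.of_forall fun t _ => ?_
    refine ContinuousAt.div continuousAt_const (by fun_prop) ?_
    simp [Real.cos_sq_add_sin_sq]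

/-! ### The singular modulus in terms of theta constants -/

theorem ellipticK_complModulus_div {a b : ℝ} (hb : 0 < b) (hab : b < a) :
    ellipticK (complModulus (b / a)) = a * gaussIntegral a b := by
  have ha : 0 < a := hb.trans hab
  have hk : b / a ∈ Set.Ioo (0 : ℝ) 1 := ⟨by positivity, (div_lt_one ha).2 hab⟩
  rw [ellipticK, gaussIntegral, ← intervalIntegral.integral_const_mul, complModulus_sq hk]
  refine intervalIntegral.integral_congr fun t _ => ?_
  have e : 1 - (1 - (b / a) ^ 2) * Real.sin t ^ 2 =
      (a ^ 2 * Real.cos t ^ 2 + b ^ 2 * Real.sin t ^ 2) / a ^ 2 := by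
    rw [Real.cos_sq']
    field_simp
    ring
  simp only [e]
  rw [Real.sqrt_div' _ (sq_nonneg a), Real.sqrt_sq ha.le]
  field_simp

theorem gaussIntegral_thetaConst_double {s : ℝ} (hs : 0 < s) :
    gaussIntegral (thetaConst s ^ 2) (thetaConstAlt s ^ 2) =
      gaussIntegral (thetaConst (2 * s) ^ 2) (thetaConstAlt (2 * s) ^ 2) := by
  have hA := thetaConst_pos hs
  have hB := thetaConstAlt_pos hs
  rw [gaussIntegral_agm (pow_pos hA 2) (pow_pos hB 2), ← mul_pow, Real.sqrt_sq (by positivity),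
    thetaConst_mul_thetaConstAlt hs, thetaConst_sq hs, thetaConstAlt_sq hs]
  congr 1
  ring

/-- The value is constant along s, 2s, 4s, … and by continuity at (1, 1) tends to the integral
there. -/
theorem gaussIntegral_thetaConst {s : ℝ} (hs : 0 < s) :
    gaussIntegral (thetaConst s ^ 2) (thetaConstAlt s ^ 2) = Real.pi / 2 := by
  have hn : ∀ n : ℕ, gaussIntegral (thetaConst (2 ^ n * s) ^ 2) (thetaConstAlt (2 ^ n * s) ^ 2) =
      gaussIntegral (thetaConst s ^ 2) (thetaConstAlt s ^ 2) := by
    intro n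
    induction n with
    | zero => simp
    | succ n ih =>
      rw [← ih, gaussIntegral_thetaConst_double (by positivity : 0 < 2 ^ n * s), ← mul_assoc,
        ← pow_succ']
  have ht : Filter.Tendsto (fun n : ℕ => (2 : ℝ) ^ n * s) Filter.atTop Filter.atTop :=
    (tendsto_pow_atTop_atTop_of_one_lt one_lt_two).atTop_mul_const hs
  have hA := (tendsto_thetaConst.comp ht).pow 2
  have hB := (tendsto_thetaConstAlt.comp ht).pow 2
  rw [one_pow] at hA hB
  have h := continuousAt_gaussIntegral_one.tendsto.comp (hA.prodMk_nhds hB)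
  rw [gaussIntegral_self_one] at h
  exact tendsto_nhds_unique (tendsto_const_nhds.congr fun n => (hn n).symm) h

theorem thetaConstAlt_sq_lt {s : ℝ} (hs : 0 < s) : thetaConstAlt s ^ 2 < thetaConst s ^ 2 := by
  rw [thetaConstAlt_sq hs, thetaConst_sq hs]
  have := pow_pos (thetaConstHalf_pos (by linarith : 0 < 2 * s)) 2
  linarith

theorem ellipticK_complModulus_thetaConst {s : ℝ} (hs : 0 < s) :
    ellipticK (complModulus (thetaConstAlt s ^ 2 / thetaConst s ^ 2)) =
      thetaConst s ^ 2 * (Real.pi / 2) := by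
  rw [ellipticK_complModulus_div (pow_pos (thetaConstAlt_pos hs) 2) (thetaConstAlt_sq_lt hs),
    gaussIntegral_thetaConst hs]

theorem thetaConst_inv_sq {s : ℝ} (hs : 0 < s) :
    thetaConst s⁻¹ ^ 2 = s * thetaConst s ^ 2 := by
  rw [thetaConst_eq_inv hs, mul_pow, div_pow, Real.sq_sqrt hs.le]
  field_simp

theorem thetaConstAlt_inv_sq {s : ℝ} (hs : 0 < s) :
    thetaConstAlt s⁻¹ ^ 2 = s * thetaConstHalf s ^ 2 := by
  rw [thetaConstAlt_eq_inv (inv_pos.2 hs), mul_pow, div_pow, Real.sq_sqrt (inv_pos.2 hs).le,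
    inv_inv]
  field_simp

/-- The quartic identity gives the complement as ϑ₂²/ϑ₃² at `s`; inversion turns this into ϑ₄²/ϑ₃²
at 1/s. -/
theorem complModulus_thetaConstAlt_div {s : ℝ} (hs : 0 < s) :
    complModulus (thetaConstAlt s ^ 2 / thetaConst s ^ 2) =
      thetaConstAlt s⁻¹ ^ 2 / thetaConst s⁻¹ ^ 2 := by
  have hA := thetaConst_pos hs
  rw [thetaConstAlt_inv_sq hs, thetaConst_inv_sq hs, mul_div_mul_left _ _ hs.ne', complModulus,
    ← Real.sqrt_sq (by positivity : 0 ≤ thetaConstHalf s ^ 2 / thetaConst s ^ 2)]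
  congr 1
  have h := thetaConst_pow_four hs
  field_simp
  linarith

theorem complModulus_singularModulus {r : ℝ} (hr : 0 < r) :
    complModulus (singularModulus r) =
      thetaConstAlt (Real.sqrt r) ^ 2 / thetaConst (Real.sqrt r) ^ 2 := by
  have hs := Real.sqrt_pos.2 hr
  have hA := pow_pos (thetaConst_pos hs) 2
  have hk : thetaConstAlt (Real.sqrt r) ^ 2 / thetaConst (Real.sqrt r) ^ 2 ∈ Set.Ioo (0 : ℝ) 1 :=
    ⟨div_pos (pow_pos (thetaConstAlt_pos hs) 2) hA, (div_lt_one hA).2 (thetaConstAlt_sq_lt hs)⟩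
  rw [(existsUnique_singularModulus r hr).unique (singularModulus_spec r hr)
    (y₂ := complModulus (thetaConstAlt (Real.sqrt r) ^ 2 / thetaConst (Real.sqrt r) ^ 2))
    ⟨complModulus_mem hk, ?_⟩, complModulus_complModulus hk]
  rw [ellipticK_complModulus_thetaConst hs, complModulus_thetaConstAlt_div hs,
    ellipticK_complModulus_thetaConst (inv_pos.2 hs), thetaConst_inv_sq hs]
  have hA' := (thetaConst_pos hs).ne'
  have := Real.pi_pos
  field_simp

/-! ### Change of sign of the nome -/

theorem theta3_neg (q z : ℂ) : theta3 (-q) z = theta4 q z := by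
  rw [theta3, theta4]
  congr 2
  refine tsum_congr fun n => ?_
  rw [neg_pow, sq, pow_mul (-1 : ℂ)]
  congr 2
  rcases Nat.even_or_odd (n + 1) with h | h
  · rw [h.neg_one_pow, one_pow]
  · rw [h.neg_one_pow, h.neg_one_pow]

theorem theta4_neg (q z : ℂ) : theta4 (-q) z = theta3 q z := by
  rw [← theta3_neg, neg_neg]

/-- Only the quotient is invariant: the principal fourth roots of `q` and `-q` differ, but cancel.
-/
theorem theta1_neg_div_theta2_neg {q : ℂ} (hq : q ≠ 0) (z w : ℂ) :
    theta1 (-q) z / theta2 (-q) w = theta1 q z / theta2 q w := by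
  have h : ∀ p : ℂ, p ≠ 0 → 2 * p ^ (1 / 4 : ℂ) ≠ 0 := fun p hp =>
    mul_ne_zero two_ne_zero (Complex.cpow_ne_zero_iff.2 (Or.inl hp))
  have e : ∀ n : ℕ, (-q) ^ (n * (n + 1)) = q ^ (n * (n + 1)) := fun n =>
    (Nat.even_mul_succ_self n).neg_pow q
  simp only [theta1, theta2, e]
  rw [mul_div_mul_left _ _ (h _ (neg_ne_zero.2 hq)), mul_div_mul_left _ _ (h _ hq)]

theorem theta2_neg_div_theta2_neg {q : ℂ} (hq : q ≠ 0) (z w : ℂ) :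
    theta2 (-q) z / theta2 (-q) w = theta2 q z / theta2 q w := by
  have h : ∀ p : ℂ, p ≠ 0 → 2 * p ^ (1 / 4 : ℂ) ≠ 0 := fun p hp =>
    mul_ne_zero two_ne_zero (Complex.cpow_ne_zero_iff.2 (Or.inl hp))
  have e : ∀ n : ℕ, (-q) ^ (n * (n + 1)) = q ^ (n * (n + 1)) := fun n =>
    (Nat.even_mul_succ_self n).neg_pow q
  simp only [theta2, e]
  rw [mul_div_mul_left _ _ (h _ (neg_ne_zero.2 hq)), mul_div_mul_left _ _ (h _ hq)]

/-! ### Theta functions at zero, and the conclusion -/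

theorem tsum_int_eq_one_add_two_mul_tsum_nat {f : ℤ → ℝ} (hf : Summable f) (h0 : f 0 = 1)
    (hf' : f.Even) : ∑' n : ℤ, f n = 1 + 2 * ∑' n : ℕ, f (n + 1) := by
  rw [tsum_int_eq_zero_add_two_mul_tsum_pnat hf' hf, h0, nsmul_eq_mul,
    tsum_pnat_eq_tsum_succ (f := fun n : ℕ => f n)]
  push_cast
  rfl

theorem theta3_zero {s : ℝ} (hs : 0 < s) :
    theta3 (Real.exp (-(Real.pi * s)) : ℝ) 0 = (thetaConst s : ℝ) := by
  rw [thetaConst, tsum_int_eq_one_add_two_mul_tsum_nat (summable_exp_neg_pi_mul_sq hs) (by simp)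
    (fun n => by simp), theta3]
  push_cast
  congr 2
  refine tsum_congr fun n => ?_
  rw [mul_zero, Complex.cos_zero, mul_one, ← Complex.exp_nat_mul]
  congr 1
  push_cast
  ring

theorem theta4_zero {s : ℝ} (hs : 0 < s) :
    theta4 (Real.exp (-(Real.pi * s)) : ℝ) 0 = (thetaConstAlt s : ℝ) := by
  rw [thetaConstAlt, tsum_int_eq_one_add_two_mul_tsum_nat
    (summable_alternating_exp_neg_pi_mul_sq hs) (by simp) (fun n => by simp [← inv_zpow]), theta4]
  push_cast
  congr 2
  refine tsum_congr fun n => ?_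
  rw [mul_zero, Complex.cos_zero, mul_one, ← Complex.exp_nat_mul]
  congr 1
  push_cast
  congr 1
  ring

theorem proposition5 (r : ℝ) (hr : 0 < r) (q : ℝ)
    (hq : q = Real.exp (-(Real.pi * Real.sqrt r))) (u : ℂ) :
    jacobiCn (-(q : ℂ)) u = jacobiCd (q : ℂ) (u / (complModulus (singularModulus r) : ℂ)) ∧
    jacobiSn (-(q : ℂ)) u = (complModulus (singularModulus r) : ℂ) *
      jacobiSd (q : ℂ) (u / (complModulus (singularModulus r) : ℂ)) := by
  have hs := Real.sqrt_pos.2 hr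
  have hq0 : (q : ℂ) ≠ 0 := by
    rw [hq]
    exact_mod_cast (Real.exp_pos _).ne'
  have h3 : theta3 q 0 ≠ 0 := by
    rw [hq, theta3_zero hs]
    exact_mod_cast (thetaConst_pos hs).ne'
  have h4 : theta4 q 0 ≠ 0 := by
    rw [hq, theta4_zero hs]
    exact_mod_cast (thetaConstAlt_pos hs).ne'
  have hk : (complModulus (singularModulus r) : ℂ) = theta4 q 0 ^ 2 / theta3 q 0 ^ 2 := by
    rw [hq, theta3_zero hs, theta4_zero hs, complModulus_singularModulus hr]
    push_cast
    rfl
  -- Here k'ϑ₃(q)² = ϑ₄(q)² = ϑ₃(-q)², so both sides have the same theta variable.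
  have hz : thetaArg q (u / (complModulus (singularModulus r) : ℂ)) = thetaArg (-q) u := by
    rw [thetaArg, thetaArg, theta3_neg, hk]
    field_simp
  -- Both sides carry the same denominator ϑ₃(z|q); where it vanishes, both take the default value
  -- 0.
  constructor
  · rw [jacobiCn, jacobiCd, hz, theta4_neg, theta4_neg, ← mul_div_assoc, div_mul_eq_mul_div,
      mul_div_assoc (theta3 _ _), theta2_neg_div_theta2_neg hq0]
    ring
  · rw [jacobiSn, jacobiSd, hz, theta4_neg, theta3_neg, ← mul_div_assoc, div_mul_eq_mul_div,
      mul_div_assoc (theta4 _ _), theta1_neg_div_theta2_neg hq0, hk]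
    field_simp

end
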